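/- **Theorem 1 (Stability and limit theorems).** Consider $n$ agents, partitioned into a set $\mathcal V_r$ of $n_r$ regular agents and a set $\mathcal V_s$ of $n_s=n-n_r$ stubborn agents, an averaging weight $q\in[0,1)$, and a symmetric matrix $W=[w_{ij}]\in\mathbb R^{n\times n}$ with nonnegative entries, zero diagonal and $\mathbf 1^TW\mathbf 1/2=1$. At each time $t\in\mathbb N$, independently of the past, a pair $\{i,j\}$ with $i\neq j$ is selected with probability $w_{ij}$. Each regular agent of the pair moves to the weighted average with weight $q$ on its own state and $1-q$ on the state of the other agent of the pair. All other agents, in particular all stubborn ones, keep their states. Write $X(t)\in\mathbb R^n$ for the state vector, $X^r(t)\in\mathbb R^{n_r}$ for the states of the regular agents and $\mathbf x^s\in\mathbb R^{n_s}$ for the constant states of the stubborn agents. Then $X^r(t+1)=A(t)X^r(t)+B(t)\mathbf x^s$ with i.i.d. random matrices $[A(t)\ B(t)]$ determined by the selected pairs. Let $\bar A=\mathbb E\{A(t)\}$ and $\bar B=\mathbb E\{B(t)\}$. Suppose that there is at least one stubborn agent ($n_r<n$) and that: - the agents are partitioned into two communities $\mathcal V_1,\mathcal V_2$ of sizes $n_1,n_2$,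 each containing at least one regular agent; - there are $w_s,w_d>0$ with $w_s\neq w_d$ such that, for $i\ne j$, $w_{ij}=w_s$ if $i$ and $j$ are in the same community and $w_{ij}=w_d$ otherwise (so $(n_1(n_1-1)+n_2(n_2-1))w_s+2n_1n_2w_d=2$); - $X(0)$ is deterministic, and every regular agent starts in $[\underline s,\overline s]$, where $\underline s$ and $\overline s$ are the smallest and the largest entry of $\mathbf x^s$. Then $I-\bar A$ is invertible, and with $\mathbf x^r:=(I-\bar A)^{-1}\bar B\mathbf x^s$ the following hold. (i) The Markov chain $X^r(t)$ has a unique stationary distribution $\pi$ on $\mathbb R^{n_r}$; the mean of $\pi$ is $\mathbf x^r$, and $X^r(t)$ converges in distribution to $\pi$ as $t\to\infty$. (ii) $\lim_{t\to\infty}\mathbb E\{X^r(t)\}=\mathbf x^r$. (iii) The time averages $S^r(t):=\frac1t\sum_{i=0}^{t-1}X^r(i)$ satisfy $\lim_{t\to\infty}S^r(t)=\mathbf x^r$ almost surely. -/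

import Mathlib

open MeasureTheory ProbabilityTheory Filter Topology

noncomputable section

/-- Data of a gossip model on `n` agents: the set of regular agents (all the others are stubborn),
the averaging weight `q ∈ [0, 1)`, the symmetric nonnegative interaction probability matrix `W`
with zero diagonal (no self-loops) and total mass `𝟏ᵀ W 𝟏 / 2 = 1`, and the deterministic initial
state vector. The interaction graph has an edge `{i, j}` exactly where `W i j > 0`. -/
structure GossipModel (n : ℕ) where
  regular : Finset (Fin n)
  q : ℝ
  q_nonneg : 0 ≤ q
  q_lt_one : q < 1
  W : Matrix (Fin n) (Fin n) ℝ
  W_symm : ∀ i j, W i j = W j i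
  W_nonneg : ∀ i j, 0 ≤ W i j
  W_diag : ∀ i, W i i = 0
  W_sum : (∑ i, ∑ j, W i j) / 2 = 1
  x0 : Fin n → ℝ

namespace GossipModel

variable {n : ℕ} (M : GossipModel n)

/-- The index type of the regular agents. -/
abbrev Reg : Type := {i : Fin n // i ∈ M.regular}

/-- The index type of the stubborn agents. -/
abbrev Stub : Type := {i : Fin n // i ∉ M.regular}

/-- The stubborn state vector `xˢ = Xˢ(0)`. -/
def xs : M.Stub → ℝ := fun j => M.x0 j

/-- The update matrix `R^{ij}` of an interaction of the agents `i` and `j`. -/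
def R (i j : Fin n) : Matrix (Fin n) (Fin n) ℝ :=
  let e : Fin n → Fin n → ℝ := fun k => Pi.single k 1
  if i ∈ M.regular then
    if j ∈ M.regular then 1 - (1 - M.q) • Matrix.vecMulVec (e i - e j) (e i - e j)
    else 1 - (1 - M.q) • Matrix.vecMulVec (e i) (e i - e j)
  else
    if j ∈ M.regular then 1 - (1 - M.q) • Matrix.vecMulVec (e j) (e j - e i)
    else 1

/-- The rows of `R^{ij}` of regular agents, in the columns of regular agents. -/
def A (i j : Fin n) : Matrix M.Reg M.Reg ℝ := (M.R i j).submatrix Subtype.val Subtype.val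

/-- The rows of `R^{ij}` of regular agents, in the columns of stubborn agents. -/
def B (i j : Fin n) : Matrix M.Reg M.Stub ℝ := (M.R i j).submatrix Subtype.val Subtype.val

/-- The unordered pairs of distinct agents, each represented by `(i, j)` with `i < j`. -/
def pairs (n : ℕ) : Finset (Fin n × Fin n) := Finset.univ.filter fun p => p.1 < p.2

/-- `edge t` is the pair of agents selected at time `t`: the selections are independent, and at
each time the pair `{i, j}`, `i < j`, is selected with probability `W i j`. -/
structure IsEdgeSelection {Ω : Type*} [MeasurableSpace Ω] (P : Measure Ω)
    (edge : ℕ → Ω → Fin n × Fin n) : Prop where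
  measurable : ∀ t, Measurable (edge t)
  indep : iIndepFun edge P
  law : ∀ t, ∀ p ∈ pairs n, P {ω | edge t ω = p} = ENNReal.ofReal (M.W p.1 p.2)

section StateSequence

variable {Ω : Type*} (edge : ℕ → Ω → Fin n × Fin n)

/-- The state vector: `X(0) = x0` and `X(t+1) = R(t) X(t)`, with `R(t) = R^{ij}` if the pair
`(i, j)` is selected at time `t`. -/
def X : ℕ → Ω → Fin n → ℝ
  | 0, _ => M.x0
  | t + 1, ω => (M.R (edge t ω).1 (edge t ω).2).mulVec (X t ω)

/-- The vector `Xʳ(t)` of the states of the regular agents. -/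
def Xr (t : ℕ) (ω : Ω) : M.Reg → ℝ := fun i => M.X edge t ω i

/-- The random matrix `A(t)`. -/
def randA (t : ℕ) (ω : Ω) : Matrix M.Reg M.Reg ℝ := M.A (edge t ω).1 (edge t ω).2

/-- The random matrix `B(t)`. -/
def randB (t : ℕ) (ω : Ω) : Matrix M.Reg M.Stub ℝ := M.B (edge t ω).1 (edge t ω).2

/-- The time average `Sʳ(t) = (1/t) ∑_{i < t} Xʳ(i)`. -/
def Sr (t : ℕ) (ω : Ω) : M.Reg → ℝ := (1 / (t : ℝ)) • ∑ i ∈ Finset.range t, M.Xr edge i ω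

end StateSequence

/-- One step `x ↦ A^{ij} x + B^{ij} xˢ` of the regular states, for the selected pair `(i, j)`. -/
def stepReg (p : Fin n × Fin n) (x : M.Reg → ℝ) : M.Reg → ℝ :=
  (M.A p.1 p.2).mulVec x + (M.B p.1 p.2).mulVec M.xs

theorem measurable_stepReg (p : Fin n × Fin n) : Measurable (M.stepReg p) := by
  have h : Continuous (M.stepReg p) := by
    unfold stepReg
    exact (continuous_const.matrix_mulVec continuous_id).add continuous_const
  exact h.measurable

/-- The transition kernel of the Markov chain of the regular states `Xʳ(t)`: from `x` it moves to
`A^{ij} x + B^{ij} xˢ` with probability `W i j`, over `i < j`. -/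
def kernel : Kernel (M.Reg → ℝ) (M.Reg → ℝ) where
  toFun x := ∑ p ∈ pairs n, ENNReal.ofReal (M.W p.1 p.2) • Measure.dirac (M.stepReg p x)
  measurable' := by
    refine Measure.measurable_of_measurable_coe _ fun s hs => ?_
    simp only [Measure.coe_finsetSum, Finset.sum_apply, Measure.smul_apply, smul_eq_mul]
    refine Finset.measurable_sum _ fun p _ => Measurable.const_mul ?_ _
    exact (Measure.measurable_coe hs).comp
      (Measure.measurable_dirac.comp (M.measurable_stepReg p))

/-- `μ` is a stationary distribution of the regular states of the gossip model. -/
def IsStationary (μ : ProbabilityMeasure (M.Reg → ℝ)) : Prop :=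
  M.kernel.Invariant (μ : Measure (M.Reg → ℝ))

/-- The size of the community with label `k`. -/
def communitySize (C : Fin n → Fin 2) (k : Fin 2) : ℕ := (Finset.univ.filter fun i => C i = k).card

/-- The two-community assumption, for the community labels `C` and the interaction probabilities
`ws` inside a community and `wd` between the communities: both communities have regular agents,
`W` has the block structure given by `C`, `ws` and `wd`, and the regular agents start
between the smallest and the largest stubborn state. -/
structure TwoCommunity (C : Fin n → Fin 2) (ws wd : ℝ) : Prop where
  regular_mem : ∀ k, ∃ i ∈ M.regular, C i = k
  ws_pos : 0 < ws
  wd_pos : 0 < wd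
  ws_ne_wd : ws ≠ wd
  block : ∀ i j, M.W i j = if i = j then 0 else if C i = C j then ws else wd
  normalized :
    let n₁ : ℝ := communitySize C 0
    let n₂ : ℝ := communitySize C 1
    (n₁ * (n₁ - 1) + n₂ * (n₂ - 1)) * ws + 2 * n₁ * n₂ * wd = 2
  init_mem : ∀ i : M.Reg, M.x0 i ∈ Set.Icc (⨅ j, M.xs j) (⨆ j, M.xs j)

end GossipModel

/-- The entrywise expectation of a random matrix. -/
def expMatrix {Ω ι κ : Type*} [MeasurableSpace Ω] (P : Measure Ω) (Y : Ω → Matrix ι κ ℝ) :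
    Matrix ι κ ℝ :=
  Matrix.of fun i j => ∫ ω, Y ω i j ∂P

end

/-! A stubborn agent interacts with every regular agent with probability at least `min ws wd`, and
each such interaction leaks a share `1 - q` of the regular agent's weight to the stubborn side.
Hence the nonnegative matrix E[A] has all row sums at most some `r < 1`: the random affine maps
contract on average, although a single one need not. This makes I - E[A] invertible, and the
deviation of the mean from the fixed point `xr` is multiplied by E[A] at each step, which gives
(ii).

For (i), the maps are composed in reverse order. Backward iterates have the same law as the forward
ones at each fixed time (`integral_forwardIter`, `integral_backwardIter`), but they are partial sums
of a random series plus a vanishing term. The row sums of A(0)⋯A(t-1) have expectation at most `r ^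
t`, so they are almost surely summable and the backward iterates converge to a limit that does not
depend on the starting point. The law of this limit is π. Equality of laws turns this into
convergence of E[g(X(t))] to the π-integral of g from every starting point and for every bounded
continuous g, and this forces invariance, uniqueness and attraction
(`invariant_iff_eq_of_tendsto_transfer`). Boundedness of the states passes the means to the limit.

For (iii), the differences X(t+1) - E[X(t+1) | past] are bounded and orthogonal, so their averages
vanish almost surely (`ae_tendsto_average_of_orthogonal`). Their sum telescopes to I - E[A] applied
to the sum of X(t) - `xr`, up to a bounded boundary term, and I - E[A] is inverted. -/

/-! ### Two probabilistic tools -/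

/-- Nonnegative random variables whose expectations have a summable bound are almost surely
summable. -/
theorem ae_summable_of_integral_le {Ω : Type*} [MeasurableSpace Ω] {P : Measure Ω}
    {f : ℕ → Ω → ℝ} {a : ℕ → ℝ} (hf : ∀ t, Integrable (f t) P) (h0 : ∀ t ω, 0 ≤ f t ω)
    (hfa : ∀ t, ∫ ω, f t ω ∂P ≤ a t) (ha : Summable a) :
    ∀ᵐ ω ∂P, Summable fun t => f t ω := by
  have ha0 : ∀ t, 0 ≤ a t := fun t => (integral_nonneg (h0 t)).trans (hfa t)
  have hmeas : ∀ t, AEMeasurable (fun ω => ENNReal.ofReal (f t ω)) P := fun t =>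
    (hf t).aemeasurable.ennreal_ofReal
  have hfin : ∫⁻ ω, ∑' t, ENNReal.ofReal (f t ω) ∂P ≠ ⊤ := by
    rw [lintegral_tsum hmeas]
    refine ne_top_of_le_ne_top ha.tsum_ofReal_ne_top (ENNReal.tsum_le_tsum fun t => ?_)
    rw [← ofReal_integral_eq_lintegral_ofReal (hf t) (ae_of_all _ (h0 t))]
    exact ENNReal.ofReal_le_ofReal (hfa t)
  filter_upwards [ae_lt_top' (AEMeasurable.tsum hmeas) hfin] with ω hω
  have := ENNReal.summable_toReal hω.ne
  simpa only [ENNReal.toReal_ofReal (h0 _ _)] using this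

/-- If the averages of a bounded sequence converge to `0` along the squares, they converge
to `0`. -/
theorem tendsto_average_of_tendsto_average_sq {u : ℕ → ℝ} {C : ℝ} (hu : ∀ t, |u t| ≤ C)
    (h : Tendsto (fun k : ℕ => (∑ t ∈ Finset.range (k ^ 2), u t) / ((k ^ 2 : ℕ) : ℝ)) atTop
      (𝓝 0)) :
    Tendsto (fun T : ℕ => (∑ t ∈ Finset.range T, u t) / T) atTop (𝓝 0) := by
  have hsq : Tendsto (fun k : ℕ => k ^ 2) atTop atTop := tendsto_pow_atTop two_ne_zero
  -- Adding `C` makes the summands nonnegative and the partial sums monotone. Since consecutive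
  -- squares have ratio tending to 1, convergence along the squares then controls all times in
  -- between.
  have key : Tendsto (fun T : ℕ => (∑ t ∈ Finset.range T, (u t + C)) / T) atTop (𝓝 C) := by
    refine tendsto_div_of_monotone_of_exists_subseq_tendsto_div
      (fun T => ∑ t ∈ Finset.range T, (u t + C)) C ?_ fun a ha => ⟨fun k => k ^ 2, ?_, hsq, ?_⟩
    · refine monotone_nat_of_le_succ fun T => ?_
      rw [Finset.sum_range_succ]
      linarith [(abs_le.1 (hu T)).1]
    · have h1 : Tendsto (fun k : ℕ => (1 + 1 / (k : ℝ)) ^ 2) atTop (𝓝 ((1 + 0) ^ 2)) :=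
        (tendsto_const_nhds.add tendsto_one_div_atTop_nhds_zero_nat).pow 2
      filter_upwards [h1.eventually_lt_const (by simpa using ha), eventually_gt_atTop 0]
        with k hk hk0
      have hk0' : (0 : ℝ) < k := by exact_mod_cast hk0
      have : ((k : ℝ) + 1) ^ 2 = (1 + 1 / (k : ℝ)) ^ 2 * k ^ 2 := by field_simp
      push_cast
      rw [this]
      gcongr
    · have := h.add_const C
      rw [zero_add] at this
      refine this.congr' ?_
      filter_upwards [eventually_gt_atTop 0] with k hk
      have hk0 : (((k ^ 2 : ℕ) : ℝ)) ≠ 0 := by positivity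
      rw [Finset.sum_add_distrib, Finset.sum_const, Finset.card_range, nsmul_eq_mul]
      field_simp
  have := key.sub_const C
  rw [sub_self] at this
  refine this.congr' ?_
  filter_upwards [eventually_gt_atTop 0] with T hT
  have hT0 : (T : ℝ) ≠ 0 := by positivity
  rw [Finset.sum_add_distrib, Finset.sum_const, Finset.card_range, nsmul_eq_mul]
  field_simp
  ring

/-- A strong law of large numbers for bounded orthogonal random variables. -/
theorem ae_tendsto_average_of_orthogonal {Ω : Type*} [MeasurableSpace Ω] {P : Measure Ω}
    [IsProbabilityMeasure P] {Y : ℕ → Ω → ℝ} {C : ℝ} (hY : ∀ t, Measurable (Y t))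
    (hC : ∀ t ω, |Y t ω| ≤ C) (horth : ∀ s t, s < t → ∫ ω, Y s ω * Y t ω ∂P = 0) :
    ∀ᵐ ω ∂P, Tendsto (fun T : ℕ => (∑ t ∈ Finset.range T, Y t ω) / T) atTop (𝓝 0) := by
  have hint : ∀ s t, Integrable (fun ω => Y s ω * Y t ω) P := fun s t => by
    refine Integrable.of_bound ((hY s).mul (hY t)).aestronglyMeasurable (C * C)
      (ae_of_all _ fun ω => ?_)
    rw [Real.norm_eq_abs, abs_mul]
    exact mul_le_mul (hC s ω) (hC t ω) (abs_nonneg _) ((abs_nonneg _).trans (hC s ω))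
  have hle : ∀ s t, ∫ ω, Y s ω * Y t ω ∂P ≤ if s = t then C ^ 2 else 0 := fun s t => by
    split_ifs with h
    · subst h
      calc ∫ ω, Y s ω * Y s ω ∂P ≤ ∫ _, C ^ 2 ∂P := by
            refine integral_mono (hint s s) (integrable_const _) fun ω => ?_
            have := sq_le_sq' (by linarith [(abs_le.1 (hC s ω)).1]) (abs_le.1 (hC s ω)).2
            simpa [sq] using this
        _ = C ^ 2 := by simp
    · rcases lt_or_gt_of_ne h with h | h
      · exact (horth s t h).le
      · rw [← horth t s h]
        exact (integral_congr_ae (ae_of_all _ fun ω => mul_comm _ _)).le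
  have hsq : ∀ T : ℕ, Integrable (fun ω => (∑ t ∈ Finset.range T, Y t ω) ^ 2) P ∧
      ∫ ω, (∑ t ∈ Finset.range T, Y t ω) ^ 2 ∂P ≤ T * C ^ 2 := fun T => by
    have he : (fun ω => (∑ t ∈ Finset.range T, Y t ω) ^ 2) = fun ω =>
        ∑ s ∈ Finset.range T, ∑ t ∈ Finset.range T, Y s ω * Y t ω := by
      funext ω
      rw [sq, Finset.sum_mul_sum]
    rw [he]
    refine ⟨integrable_finsetSum _ fun s _ => integrable_finsetSum _ fun t _ => hint s t, ?_⟩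
    rw [integral_finsetSum _ fun s _ => integrable_finsetSum _ fun t _ => hint s t]
    calc _ ≤ ∑ s ∈ Finset.range T, C ^ 2 := by
          refine Finset.sum_le_sum fun s hs => ?_
          rw [integral_finsetSum _ fun t _ => hint s t]
          refine (Finset.sum_le_sum fun t _ => hle s t).trans ?_
          rw [Finset.sum_ite_eq, if_pos hs]
      _ = T * C ^ 2 := by simp
  -- By orthogonality the average over `k ^ 2` terms has second moment at most `C ^ 2 / k ^ 2`,
  -- which is summable in `k`; along all times the bound would only be harmonic.
  have hsum := ae_summable_of_integral_le (P := P)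
    (f := fun k ω => (∑ t ∈ Finset.range (k ^ 2), Y t ω) ^ 2 / (((k ^ 2 : ℕ) : ℝ)) ^ 2)
    (a := fun k => C ^ 2 * (1 / (k : ℝ) ^ 2))
    (fun k => (hsq (k ^ 2)).1.div_const _) (fun k ω => by positivity)
    (fun k => by
      rw [integral_div]
      rcases Nat.eq_zero_or_pos k with rfl | hk
      · simp
      have hk0 : (0 : ℝ) < k := by exact_mod_cast hk
      rw [div_le_iff₀ (by positivity)]
      refine (hsq (k ^ 2)).2.trans (le_of_eq ?_)
      push_cast
      field_simp)
    ((Real.summable_one_div_nat_pow.2 one_lt_two).mul_left _)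
  filter_upwards [hsum] with ω hω
  refine tendsto_average_of_tendsto_average_sq (fun t => hC t ω) ?_
  have h2 := hω.tendsto_atTop_zero
  have h3 := (Real.continuous_sqrt.tendsto 0).comp h2
  rw [Real.sqrt_zero] at h3
  refine (tendsto_zero_iff_abs_tendsto_zero _).2 (h3.congr fun k => ?_)
  simp only [Function.comp_apply, ← div_pow, Real.sqrt_sq_eq_abs]

/-! ### Iterated random functions -/

section Iterates

variable {α V : Type*}

/-- The state at time `t` of the dynamics `x ↦ F (s t) x` started from `x`. -/
def forwardIter (F : α → V → V) (s : ℕ → α) (x : V) : ℕ → V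
  | 0 => x
  | t + 1 => F (s t) (forwardIter F s x t)

/-- The backward iterates `F (s 0) (F (s 1) (⋯ (F (s (t - 1)) x)))`. -/
def backwardIter (F : α → V → V) (s : ℕ → α) : ℕ → V → V
  | 0, x => x
  | t + 1, x => backwardIter F s t (F (s t) x)

/-- The operator `g ↦ E[g (F p ·)]` for random `p` with weights `w`. -/
def transfer [Fintype α] (w : α → ℝ) (F : α → V → V) (g : V → ℝ) : V → ℝ :=
  fun x => ∑ p, w p * g (F p x)

theorem forwardIter_congr (F : α → V → V) {s s' : ℕ → α} (x : V) :
    ∀ t, (∀ i < t, s i = s' i) → forwardIter F s x t = forwardIter F s' x t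
  | 0, _ => rfl
  | t + 1, h => by
    rw [forwardIter, forwardIter, h t (Nat.lt_succ_self t),
      forwardIter_congr F x t fun i hi => h i (hi.trans (Nat.lt_succ_self t))]

theorem backwardIter_congr (F : α → V → V) {s s' : ℕ → α} :
    ∀ (t : ℕ) (x : V), (∀ i < t, s i = s' i) → backwardIter F s t x = backwardIter F s' t x
  | 0, _, _ => rfl
  | t + 1, x, h => by
    rw [backwardIter, backwardIter, h t (Nat.lt_succ_self t),
      backwardIter_congr F t _ fun i hi => h i (hi.trans (Nat.lt_succ_self t))]

theorem dependsOn_forwardIter (F : α → V → V) (x : V) (t : ℕ) :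
    DependsOn (fun s => forwardIter F s x t) {i | i ∈ Finset.range t} := fun _ _ h =>
  forwardIter_congr F x t fun i hi => h i (Finset.mem_range.2 hi)

theorem dependsOn_backwardIter (F : α → V → V) (x : V) (t : ℕ) :
    DependsOn (fun s => backwardIter F s t x) {i | i ∈ Finset.range t} := fun _ _ h =>
  backwardIter_congr F t x fun i hi => h i (Finset.mem_range.2 hi)

end Iterates

/-! ### Expectations over independent selections -/

/-- `e` is a sequence of independent random variables with point masses `w`. -/
structure IsIIDWithWeights {α Ω : Type*} [MeasurableSpace α] [MeasurableSpace Ω] (P : Measure Ω)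
    (e : ℕ → Ω → α) (w : α → ℝ) : Prop where
  measurable : ∀ t, Measurable (e t)
  indep : iIndepFun e P
  law : ∀ t p, P.real {ω | e t ω = p} = w p

namespace IsIIDWithWeights

variable {α Ω : Type*} [MeasurableSpace α] [MeasurableSpace Ω] {P : Measure Ω}
  {e : ℕ → Ω → α} {w : α → ℝ}

theorem weight_nonneg (he : IsIIDWithWeights P e w) (p : α) : 0 ≤ w p :=
  he.law 0 p ▸ measureReal_nonneg

variable [Fintype α] [MeasurableSingletonClass α] [IsProbabilityMeasure P]

/-- A function of finitely many coordinates in a finite alphabet factors through a countable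
discrete space, so no regularity of `H` is needed. -/
theorem measurable_of_dependsOn (he : IsIIDWithWeights P e w) {β : Type*} [MeasurableSpace β]
    {H : (ℕ → α) → β} {S : Finset ℕ} (hH : DependsOn H {i | i ∈ S}) :
    Measurable fun ω => H fun i => e i ω := by
  have : Nonempty Ω := P.nonempty_of_neZero
  have : Nonempty β := ⟨H fun i => e i (Classical.arbitrary Ω)⟩
  obtain ⟨g, hg⟩ := dependsOn_iff_exists_comp.1 hH
  have hg' : Measurable (g : (({i | i ∈ S} : Set ℕ) → α) → β) := measurable_of_countable g
  rw [hg]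
  exact hg'.comp (measurable_pi_lambda _ fun i => he.measurable i)

theorem integrable_of_dependsOn (he : IsIIDWithWeights P e w)
    {H : (ℕ → α) → ℝ} {S : Finset ℕ} (hH : DependsOn H {i | i ∈ S}) :
    Integrable (fun ω => H fun i => e i ω) P := by
  obtain ⟨g, hg⟩ := dependsOn_iff_exists_comp.1 hH
  obtain ⟨C, hC⟩ := (Set.finite_range fun v => ‖g v‖).bddAbove
  refine Integrable.of_bound (he.measurable_of_dependsOn hH).aestronglyMeasurable C
    (ae_of_all _ fun ω => ?_)
  rw [hg]
  exact hC ⟨_, rfl⟩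

theorem integral_mul_ite (he : IsIIDWithWeights P e w) [DecidableEq α] {t : ℕ}
    {H : (ℕ → α) → ℝ} (hH : DependsOn H {i | i ∈ Finset.range t}) (p : α) :
    ∫ ω, (H fun i => e i ω) * (if e t ω = p then 1 else 0) ∂P =
      w p * ∫ ω, H fun i => e i ω ∂P := by
  obtain ⟨g, hg⟩ := dependsOn_iff_exists_comp.1 hH
  have hind : IndepFun (fun ω => H fun i => e i ω) (fun ω => if e t ω = p then (1 : ℝ) else 0)
      P := by
    have h1 := he.indep.indepFun_finset (Finset.range t) {t} (by simp) he.measurable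
    have h2 := h1.comp (φ := fun v => g v) (ψ := fun v => if v ⟨t, by simp⟩ = p then (1 : ℝ) else 0)
      (measurable_of_countable _) (measurable_of_countable _)
    rw [hg]
    exact h2
  have h1 : ∫ ω, (if e t ω = p then (1 : ℝ) else 0) ∂P = w p := by
    rw [← he.law t p]
    have hm : MeasurableSet {ω | e t ω = p} := he.measurable t (measurableSet_singleton p)
    rw [← integral_indicator_one hm]
    exact integral_congr_ae (ae_of_all _ fun ω => by simp [Set.indicator])
  have hm : Measurable fun ω => if e t ω = p then (1 : ℝ) else 0 :=
    Measurable.ite (he.measurable t (measurableSet_singleton p)) measurable_const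
      measurable_const
  rw [hind.integral_fun_mul_eq_mul_integral
    (he.measurable_of_dependsOn hH).aestronglyMeasurable hm.aestronglyMeasurable, h1, mul_comm]

/-- Integrating out the last variable. -/
theorem integral_past_present (he : IsIIDWithWeights P e w) {t : ℕ}
    {H : (ℕ → α) → α → ℝ} (hH : ∀ p, DependsOn (fun s => H s p) {i | i ∈ Finset.range t}) :
    ∫ ω, H (fun i => e i ω) (e t ω) ∂P = ∑ p, w p * ∫ ω, H (fun i => e i ω) p ∂P := by
  classical
  have h1 : ∀ ω, H (fun i => e i ω) (e t ω) =
      ∑ p, H (fun i => e i ω) p * (if e t ω = p then 1 else 0) := fun ω => by simp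
  simp_rw [h1]
  rw [integral_finsetSum]
  · exact Finset.sum_congr rfl fun p _ => he.integral_mul_ite (hH p) p
  · intro p _
    refine he.integrable_of_dependsOn (S := Finset.range (t + 1))
      (H := fun s => H s p * (if s t = p then 1 else 0)) fun s s' hs => ?_
    simp only
    rw [hs t (by simp)]
    exact congrArg (· * _) (hH p fun i hi => hs i (by simp at hi ⊢; omega))

theorem integral_apply (he : IsIIDWithWeights P e w) (t : ℕ) (h : α → ℝ) :
    ∫ ω, h (e t ω) ∂P = ∑ p, w p * h p := by
  simpa using he.integral_past_present (t := t) (H := fun _ p => h p) fun p _ _ _ => rfl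

theorem sum_weight (he : IsIIDWithWeights P e w) : ∑ p, w p = 1 := by
  simpa using (he.integral_apply 0 fun _ => 1).symm

variable {V : Type*} (F : α → V → V)

/-- The last selected map is the outermost one, so integrating it out replaces the test function `g`
by its transfer. -/
theorem integral_forwardIter (he : IsIIDWithWeights P e w) (x : V) :
    ∀ (t : ℕ) (g : V → ℝ), ∫ ω, g (forwardIter F (fun i => e i ω) x t) ∂P =
      (transfer w F)^[t] g x
  | 0, g => by simp [forwardIter]
  | t + 1, g => by
    rw [Function.iterate_succ_apply, ← integral_forwardIter he x t]
    simp only [forwardIter]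
    have hd : ∀ p, DependsOn (fun s => g (F p (forwardIter F s x t)))
        {i | i ∈ Finset.range t} := fun p _ _ h =>
      congrArg (fun y => g (F p y)) (dependsOn_forwardIter F x t h)
    rw [he.integral_past_present (H := fun s p => g (F p (forwardIter F s x t))) hd]
    simp only [transfer]
    rw [integral_finsetSum _ fun p _ => (he.integrable_of_dependsOn (hd p)).const_mul _]
    simp_rw [integral_const_mul]

/-- Here the last selected map is the innermost one, so integrating it out averages over starting
points. The result is the same as for forward iterates: at a fixed time both have the same law. -/
theorem integral_backwardIter (he : IsIIDWithWeights P e w) (g : V → ℝ) :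
    ∀ (t : ℕ) (x : V), ∫ ω, g (backwardIter F (fun i => e i ω) t x) ∂P =
      (transfer w F)^[t] g x
  | 0, x => by simp [backwardIter]
  | t + 1, x => by
    rw [Function.iterate_succ_apply']
    simp only [backwardIter, transfer]
    rw [he.integral_past_present (H := fun s p => g (backwardIter F s t (F p x))) fun p _ _ h =>
      congrArg g (dependsOn_backwardIter F _ t h)]
    simp_rw [integral_backwardIter he g t]

end IsIIDWithWeights

/-! ### Random affine maps that contract on average -/

section Affine

variable {α ι : Type*} [Fintype ι]

/-- The affine maps `x ↦ A p x + b p`. -/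
def affineStep (A : α → Matrix ι ι ℝ) (b : α → ι → ℝ) (p : α) (x : ι → ℝ) : ι → ℝ :=
  (A p).mulVec x + b p

/-- The product `A (s 0) A (s 1) ⋯ A (s (t - 1))`. -/
def matrixProd [DecidableEq ι] (A : α → Matrix ι ι ℝ) (s : ℕ → α) : ℕ → Matrix ι ι ℝ
  | 0 => 1
  | t + 1 => matrixProd A s t * A (s t)

theorem Matrix.abs_mulVec_le_of_nonneg {D : Matrix ι ι ℝ} (hD : ∀ i j, 0 ≤ D i j) {x : ι → ℝ}
    {c : ℝ} (hx : ∀ i, |x i| ≤ c) (i : ι) : |D.mulVec x i| ≤ c * D.mulVec 1 i := by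
  simp only [Matrix.mulVec, dotProduct, Pi.one_apply, mul_one, Finset.mul_sum]
  refine (Finset.abs_sum_le_sum_abs _ _).trans (Finset.sum_le_sum fun j _ => ?_)
  rw [abs_mul, abs_of_nonneg (hD i j), mul_comm c]
  exact mul_le_mul_of_nonneg_left (hx j) (hD i j)

/-- The mean of the matrices `A p` with weights `w`. -/
def meanMatrix [Fintype α] {κ : Type*} (w : α → ℝ) (A : α → Matrix ι κ ℝ) : Matrix ι κ ℝ :=
  ∑ p, w p • A p

theorem sum_mul_affineStep [Fintype α] (w : α → ℝ) (A : α → Matrix ι ι ℝ) (b : α → ι → ℝ)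
    (x : ι → ℝ) :
    ∑ p, w p • affineStep A b p x = (meanMatrix w A).mulVec x + ∑ p, w p • b p := by
  simp only [affineStep, smul_add, Finset.sum_add_distrib, meanMatrix, Matrix.sum_mulVec,
    Matrix.smul_mulVec]

variable [DecidableEq ι]

theorem matrixProd_nonneg {A : α → Matrix ι ι ℝ} (hA : ∀ p i j, 0 ≤ A p i j) (s : ℕ → α) :
    ∀ t i j, 0 ≤ matrixProd A s t i j
  | 0, i, j => by
    rw [matrixProd, Matrix.one_apply]
    split_ifs <;> norm_num
  | t + 1, i, j => by
    rw [matrixProd, Matrix.mul_apply]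
    exact Finset.sum_nonneg fun k _ => mul_nonneg (matrixProd_nonneg hA s t i k) (hA _ k j)

/-- A new map enters innermost, so earlier terms of the sum never change. This is why backward
iterates can converge pathwise while forward ones keep fluctuating. -/
theorem backwardIter_affineStep (A : α → Matrix ι ι ℝ) (b : α → ι → ℝ) (s : ℕ → α) :
    ∀ (t : ℕ) (x : ι → ℝ), backwardIter (affineStep A b) s t x =
      (matrixProd A s t).mulVec x + ∑ k ∈ Finset.range t, (matrixProd A s k).mulVec (b (s k))
  | 0, x => by simp [backwardIter, matrixProd]
  | t + 1, x => by
    rw [backwardIter, backwardIter_affineStep A b s t, affineStep, Matrix.mulVec_add,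
      Finset.sum_range_succ, matrixProd, Matrix.mulVec_mulVec]
    abel

/-- A nonnegative matrix with row sums at most `r < 1` is a contraction. -/
theorem Matrix.pow_mulVec_one_le {D : Matrix ι ι ℝ} (hD : ∀ i j, 0 ≤ D i j) {r : ℝ}
    (hr : ∀ i, D.mulVec 1 i ≤ r) (t : ℕ) (i : ι) : (D ^ t).mulVec 1 i ≤ r ^ t := by
  induction t generalizing i with
  | zero => simp
  | succ t ih =>
    have hr0 : 0 ≤ r := le_trans (by
      simpa [Matrix.mulVec, dotProduct] using Finset.sum_nonneg fun j _ => hD i j) (hr i)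
    rw [pow_succ', ← Matrix.mulVec_mulVec]
    calc D.mulVec ((D ^ t).mulVec 1) i ≤ r ^ t * D.mulVec 1 i := by
          simp only [Matrix.mulVec, dotProduct, Pi.one_apply, mul_one, Finset.mul_sum] at ih ⊢
          refine Finset.sum_le_sum fun j _ => ?_
          rw [← Finset.mul_sum, mul_comm (r ^ t)]
          exact mul_le_mul_of_nonneg_left (ih j) (hD i j)
      _ ≤ r ^ (t + 1) := by
          rw [pow_succ]
          exact mul_le_mul_of_nonneg_left (hr i) (pow_nonneg hr0 t)

theorem Matrix.pow_nonneg_apply {D : Matrix ι ι ℝ} (hD : ∀ i j, 0 ≤ D i j) (t : ℕ) :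
    ∀ i j, 0 ≤ (D ^ t) i j := by
  induction t with
  | zero =>
    intro i j
    rw [pow_zero, Matrix.one_apply]
    split_ifs <;> norm_num
  | succ t ih =>
    intro i j
    rw [pow_succ, Matrix.mul_apply]
    exact Finset.sum_nonneg fun k _ => mul_nonneg (ih i k) (hD k j)

theorem Matrix.tendsto_pow_mulVec {D : Matrix ι ι ℝ} (hD : ∀ i j, 0 ≤ D i j) {r : ℝ}
    (hr0 : 0 ≤ r) (hr1 : r < 1) (hr : ∀ i, D.mulVec 1 i ≤ r) (x : ι → ℝ) (i : ι) :
    Tendsto (fun t : ℕ => (D ^ t).mulVec x i) atTop (𝓝 0) := by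
  have h := (tendsto_pow_atTop_nhds_zero_of_lt_one hr0 hr1).const_mul ‖x‖
  rw [mul_zero] at h
  refine squeeze_zero_norm (fun t => ?_) h
  refine (Matrix.abs_mulVec_le_of_nonneg (Matrix.pow_nonneg_apply hD t)
    (fun j => norm_le_pi_norm x j) i).trans ?_
  exact mul_le_mul_of_nonneg_left (Matrix.pow_mulVec_one_le hD hr t i) (norm_nonneg x)

/-- A kernel vector of `1 - D` is fixed by every power of `D`, and these powers tend to zero. -/
theorem Matrix.isUnit_one_sub_of_nonneg {D : Matrix ι ι ℝ} (hD : ∀ i j, 0 ≤ D i j) {r : ℝ}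
    (hr0 : 0 ≤ r) (hr1 : r < 1) (hr : ∀ i, D.mulVec 1 i ≤ r) : IsUnit (1 - D) := by
  rw [← Matrix.mulVec_injective_iff_isUnit]
  refine (injective_iff_map_eq_zero (Matrix.mulVecLin (1 - D))).2 fun v hv => ?_
  rw [Matrix.mulVecLin_apply, Matrix.sub_mulVec, Matrix.one_mulVec, sub_eq_zero] at hv
  have hpow : ∀ t : ℕ, (D ^ t).mulVec v = v := fun t => by
    induction t with
    | zero => simp
    | succ t ih => rw [pow_succ, ← Matrix.mulVec_mulVec, ← hv, ih]
  funext i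
  have h := Matrix.tendsto_pow_mulVec hD hr0 hr1 hr v i
  simp only [hpow] at h
  exact tendsto_nhds_unique tendsto_const_nhds h

/-- The deviation from the fixed point `xr` of the averaged map is multiplied by the mean matrix at
each step, because expectation commutes with affine maps. -/
theorem transfer_iterate_eval [Fintype α] {w : α → ℝ} (hw : ∑ p, w p = 1) (A : α → Matrix ι ι ℝ)
    (b : α → ι → ℝ) {xr : ι → ℝ} (hxr : (meanMatrix w A).mulVec xr + ∑ p, w p • b p = xr)
    (i : ι) (t : ℕ) (x : ι → ℝ) :
    (transfer w (affineStep A b))^[t] (fun y => y i) x =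
      xr i + (meanMatrix w A ^ t).mulVec (x - xr) i := by
  induction t generalizing x with
  | zero => simp
  | succ t ih =>
    rw [Function.iterate_succ_apply']
    simp only [transfer, ih, mul_add, Finset.sum_add_distrib]
    rw [← Finset.sum_mul, hw, one_mul, pow_succ, ← Matrix.mulVec_mulVec, Matrix.mulVec_sub _ x xr,
      ← add_sub_add_right_eq_sub _ _ (∑ p, w p • b p), hxr, ← sum_mul_affineStep]
    have : ∑ p, w p • affineStep A b p x - xr = ∑ p, w p • (affineStep A b p x - xr) := by
      simp only [smul_sub, Finset.sum_sub_distrib, ← Finset.sum_smul, hw, one_smul]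
    rw [this, Matrix.mulVec_sum]
    simp [Matrix.mulVec_smul]

end Affine

/-- Convergence of the backward iterates, for one sequence of maps. -/
theorem exists_tendsto_backwardIter {α ι : Type*} [Fintype ι] [DecidableEq ι] [Finite α]
    {A : α → Matrix ι ι ℝ} (b : α → ι → ℝ) (hA : ∀ p i j, 0 ≤ A p i j) {s : ℕ → α}
    (hs : ∀ i, Summable fun t => (matrixProd A s t).mulVec 1 i) :
    ∃ y, ∀ x, Tendsto (fun t => backwardIter (affineStep A b) s t x) atTop (𝓝 y) := by
  obtain ⟨c, hc⟩ := (Set.finite_range fun p => ‖b p‖).bddAbove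
  refine ⟨fun i => ∑' k, (matrixProd A s k).mulVec (b (s k)) i, fun x => ?_⟩
  refine tendsto_pi_nhds.2 fun i => ?_
  simp only [backwardIter_affineStep, Pi.add_apply, Finset.sum_apply]
  -- The starting point enters only through this vanishing term, so the limit is the same for all
  -- `x`.
  have h1 : Tendsto (fun t => (matrixProd A s t).mulVec x i) atTop (𝓝 0) := by
    have h := (hs i).tendsto_atTop_zero.const_mul ‖x‖
    rw [mul_zero] at h
    exact squeeze_zero_norm (fun t => Matrix.abs_mulVec_le_of_nonneg (matrixProd_nonneg hA s t)
      (fun j => norm_le_pi_norm x j) i) h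
  have h2 : Summable fun k => (matrixProd A s k).mulVec (b (s k)) i :=
    Summable.of_norm_bounded ((hs i).mul_left c) fun k =>
      Matrix.abs_mulVec_le_of_nonneg (matrixProd_nonneg hA s k)
        (fun j => (norm_le_pi_norm (b (s k)) j).trans (hc ⟨s k, rfl⟩)) i
  simpa using h1.add h2.hasSum.tendsto_sum_nat

/-! ### Almost sure limits of random affine iterations -/

namespace IsIIDWithWeights

theorem meanMatrix_nonneg {α ι Ω : Type*} [Fintype α] [MeasurableSpace α] [MeasurableSpace Ω]
    {P : Measure Ω} {e : ℕ → Ω → α} {w : α → ℝ} {A : α → Matrix ι ι ℝ}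
    (he : IsIIDWithWeights P e w) (hA : ∀ p i j, 0 ≤ A p i j) (i j : ι) :
    0 ≤ meanMatrix w A i j := by
  simp only [meanMatrix, Matrix.sum_apply, Matrix.smul_apply, smul_eq_mul]
  exact Finset.sum_nonneg fun p _ => mul_nonneg (he.weight_nonneg p) (hA p i j)

variable {α ι Ω : Type*} [Fintype α] [Fintype ι] [DecidableEq ι] [MeasurableSpace α]
  [MeasurableSingletonClass α] [MeasurableSpace Ω] {P : Measure Ω} [IsProbabilityMeasure P]
  {e : ℕ → Ω → α} {w : α → ℝ} {A : α → Matrix ι ι ℝ} {b : α → ι → ℝ} {r : ℝ}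

/-- By independence the row sums of the random products have expectation given by powers of the mean
matrix, hence at most `r ^ t`, and they are almost surely summable. -/
theorem exists_ae_tendsto_backwardIter (he : IsIIDWithWeights P e w) (b : α → ι → ℝ)
    (hA : ∀ p i j, 0 ≤ A p i j) (hr0 : 0 ≤ r) (hr1 : r < 1)
    (hr : ∀ i, (meanMatrix w A).mulVec 1 i ≤ r) :
    ∃ Y : Ω → ι → ℝ, AEMeasurable Y P ∧ ∀ᵐ ω ∂P, ∀ x,
      Tendsto (fun t => backwardIter (affineStep A b) (fun i => e i ω) t x) atTop
        (𝓝 (Y ω)) := by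
  -- With zero offsets the row sums are themselves backward iterates, so the expectation formula for
  -- backward iterates applies to them, with fixed point 0.
  have hback : ∀ s t, backwardIter (affineStep A 0) s t 1 = (matrixProd A s t).mulVec 1 :=
    fun s t => by simp [backwardIter_affineStep]
  have hdep : ∀ i t, DependsOn (fun s => (matrixProd A s t).mulVec 1 i)
      {k | k ∈ Finset.range t} := fun i t s s' h => by
    simp only [← hback]
    exact congrArg (fun y => y i) (dependsOn_backwardIter (affineStep A 0) 1 t h)
  have hsum : ∀ᵐ ω ∂P, ∀ i, Summable fun t =>
      (matrixProd A (fun k => e k ω) t).mulVec 1 i := by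
    refine ae_all_iff.2 fun i => ?_
    refine ae_summable_of_integral_le (a := fun t => r ^ t)
      (fun t => he.integrable_of_dependsOn (hdep i t)) (fun t ω => ?_) (fun t => ?_)
      (summable_geometric_of_lt_one hr0 hr1)
    · simp only [Matrix.mulVec, dotProduct, Pi.one_apply, mul_one]
      exact Finset.sum_nonneg fun j _ => matrixProd_nonneg hA _ t i j
    · simp only [← hback]
      rw [he.integral_backwardIter (affineStep A 0) (fun y => y i) t 1,
        transfer_iterate_eval he.sum_weight A 0 (xr := 0) (by simp) i t 1, sub_zero,
        Pi.zero_apply, zero_add]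
      exact Matrix.pow_mulVec_one_le (he.meanMatrix_nonneg hA) hr t i
  have hex : ∀ᵐ ω ∂P, ∃ y, ∀ x,
      Tendsto (fun t => backwardIter (affineStep A b) (fun i => e i ω) t x) atTop (𝓝 y) := by
    filter_upwards [hsum] with ω hω using exists_tendsto_backwardIter b hA hω
  classical
  -- The value 0 is used only on a null set. Measurability of this pointwise choice is recovered
  -- from the almost sure limit.
  let Y : Ω → ι → ℝ := fun ω => if h : ∃ y, ∀ x, Tendsto
    (fun t => backwardIter (affineStep A b) (fun i => e i ω) t x) atTop (𝓝 y) then h.choose else 0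
  have hY : ∀ᵐ ω ∂P, ∀ x,
      Tendsto (fun t => backwardIter (affineStep A b) (fun i => e i ω) t x) atTop
        (𝓝 (Y ω)) := by
    filter_upwards [hex] with ω hω
    simp only [Y, dif_pos hω]
    exact hω.choose_spec
  refine ⟨Y, ?_, hY⟩
  refine aemeasurable_of_tendsto_metrizable_ae atTop
    (fun t => (he.measurable_of_dependsOn (dependsOn_backwardIter (affineStep A b) 0 t)).aemeasurable)
    ?_
  filter_upwards [hY] with ω hω using hω 0

/-- The law of large numbers for the forward iterates. -/
theorem ae_tendsto_average_forwardIter (he : IsIIDWithWeights P e w)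
    (hunit : IsUnit (1 - meanMatrix w A)) {xr : ι → ℝ}
    (hxr : (meanMatrix w A).mulVec xr + ∑ p, w p • b p = xr) {x : ι → ℝ} {C : ℝ}
    (hx : ∀ i, |x i| ≤ C)
    (hC : ∀ p y, (∀ i, |y i| ≤ C) → ∀ i, |affineStep A b p y i| ≤ C) :
    ∀ᵐ ω ∂P, Tendsto (fun T : ℕ => (1 / (T : ℝ)) •
      ∑ t ∈ Finset.range T, forwardIter (affineStep A b) (fun i => e i ω) x t) atTop (𝓝 xr) := by
  set F := affineStep A b with hF
  set D := meanMatrix w A with hDdef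
  -- The conditional mean of the next state, given the present state.
  let m : (ι → ℝ) → ι → ℝ := fun y => ∑ p, w p • F p y
  have hm : ∀ y, m y = D.mulVec y + ∑ p, w p • b p := sum_mul_affineStep w A b
  have hfw : ∀ s t i, |forwardIter F s x t i| ≤ C := fun s t => by
    induction t with
    | zero => exact hx
    | succ t ih => exact hC _ _ ih
  have hmC : ∀ y, (∀ i, |y i| ≤ C) → ∀ i, |m y i| ≤ C := fun y hy i => by
    simp only [m, Finset.sum_apply, Pi.smul_apply, smul_eq_mul]
    calc _ ≤ ∑ p, w p * C := (Finset.abs_sum_le_sum_abs _ _).trans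
          (Finset.sum_le_sum fun p _ => by
            rw [abs_mul, abs_of_nonneg (he.weight_nonneg p)]
            exact mul_le_mul_of_nonneg_left (hC p y hy i) (he.weight_nonneg p))
      _ = C := by rw [← Finset.sum_mul, he.sum_weight, one_mul]
  -- Martingale differences: for `s < t`, `Y s` is a function of the selections before time `t`,
  -- given which `Y t` has mean zero.
  let Y : (ℕ → α) → ℕ → ι → ℝ := fun s t => forwardIter F s x (t + 1) - m (forwardIter F s x t)
  have hYdep : ∀ t i, DependsOn (fun s => Y s t i) {k | k ∈ Finset.range (t + 1)} :=
    fun t i s s' h => by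
    have h1 := dependsOn_forwardIter F x (t + 1) h
    have h2 := dependsOn_forwardIter F x t fun k hk => h k (by simp at hk ⊢; omega)
    simp only [Y] at h1 h2 ⊢
    rw [h1, h2]
  have hlln : ∀ᵐ ω ∂P, ∀ i, Tendsto (fun T : ℕ =>
      (∑ t ∈ Finset.range T, Y (fun k => e k ω) t i) / T) atTop (𝓝 0) := by
    refine ae_all_iff.2 fun i => ?_
    refine ae_tendsto_average_of_orthogonal (C := C + C)
      (fun t => he.measurable_of_dependsOn (hYdep t i)) (fun t ω => ?_) fun s t hst => ?_
    · simp only [Y, Pi.sub_apply]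
      exact (abs_sub _ _).trans (add_le_add (hfw _ _ i) (hmC _ (hfw _ t) i))
    · have hdep : ∀ p, DependsOn (fun σ => Y σ s i *
          (F p (forwardIter F σ x t) i - m (forwardIter F σ x t) i))
          {k | k ∈ Finset.range t} := fun p σ σ' h => by
        have h1 := hYdep s i fun k hk => h k (by simp at hk ⊢; omega)
        have h2 := dependsOn_forwardIter F x t h
        simp only at h1 h2 ⊢
        rw [h1, h2]
      have := he.integral_past_present (t := t) (H := fun σ p => Y σ s i *
        (F p (forwardIter F σ x t) i - m (forwardIter F σ x t) i)) hdep
      refine this.trans ?_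
      simp_rw [← integral_const_mul]
      rw [← integral_finsetSum _ fun p _ => (he.integrable_of_dependsOn (hdep p)).const_mul _]
      refine integral_eq_zero_of_ae (ae_of_all _ fun ω => ?_)
      simp_rw [mul_left_comm (w _), ← Finset.mul_sum, mul_sub, Finset.sum_sub_distrib,
        ← Finset.sum_mul, he.sum_weight, one_mul]
      simp [m]
  filter_upwards [hlln] with ω hω
  set Xs := forwardIter F (fun k => e k ω) x with hXs
  have hlim : Tendsto (fun T : ℕ => (1 - D)⁻¹.mulVec fun i =>
      (∑ t ∈ Finset.range T, Y (fun k => e k ω) t i) / T - (Xs T i - x i) / T) atTop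
      (𝓝 ((1 - D)⁻¹.mulVec 0)) := by
    have hcont : Continuous fun v : ι → ℝ => (1 - D)⁻¹.mulVec v :=
      continuous_const.matrix_mulVec continuous_id
    refine (hcont.tendsto 0).comp (tendsto_pi_nhds.2 fun i => ?_)
    have h1 : Tendsto (fun T : ℕ => (Xs T i - x i) / T) atTop (𝓝 0) := by
      have h := tendsto_const_div_atTop_nhds_zero_nat (C + C)
      refine squeeze_zero_norm (fun T => ?_) h
      rw [Real.norm_eq_abs, abs_div, Nat.abs_cast]
      exact div_le_div_of_nonneg_right
        ((abs_sub _ _).trans (add_le_add (hfw _ T i) (hx i))) (Nat.cast_nonneg T)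
    simpa using (hω i).sub h1
  rw [Matrix.mulVec_zero] at hlim
  have hlim2 := hlim.add_const xr
  rw [zero_add] at hlim2
  refine hlim2.congr' ?_
  filter_upwards [eventually_gt_atTop 0] with T hT
  have hT0 : (T : ℝ) ≠ 0 := by positivity
  have hcancel : ∀ v : ι → ℝ, (1 - D)⁻¹.mulVec ((1 - D).mulVec v) = v := fun v => by
    rw [Matrix.mulVec_mulVec, Matrix.nonsing_inv_mul _ ((Matrix.isUnit_iff_isUnit_det _).1 hunit),
      Matrix.one_mulVec]
  -- Since `xr` is fixed by `m`, each `Y t` is (X(t+1) - `xr`) - `D` (X(t) - `xr`); summation leaves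
  -- only the boundary term outside `1 - D`.
  have hsum : ∀ T : ℕ, ∑ t ∈ Finset.range T, Y (fun k => e k ω) t - (Xs T - x) =
      (1 - D).mulVec (∑ t ∈ Finset.range T, (Xs t - xr)) := fun T => by
    induction T with
    | zero => simp [hXs, forwardIter]
    | succ T ih =>
      rw [Finset.sum_range_succ, Finset.sum_range_succ, Matrix.mulVec_add, ← ih]
      simp only [Y, hm, ← hXs, Matrix.sub_mulVec, Matrix.one_mulVec, Matrix.mulVec_sub]
      rw [eq_sub_of_add_eq hxr]
      abel
  have heq : (fun i => (∑ t ∈ Finset.range T, Y (fun k => e k ω) t i) / T -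
      (Xs T i - x i) / T) =
      (1 - D).mulVec ((1 / (T : ℝ)) • ∑ t ∈ Finset.range T, (Xs t - xr)) := by
    rw [Matrix.mulVec_smul, ← hsum]
    funext i
    simp only [Pi.smul_apply, Pi.sub_apply, Finset.sum_apply, smul_eq_mul]
    ring
  rw [heq, hcancel, Finset.sum_sub_distrib, Finset.sum_const, Finset.card_range, smul_sub,
    ← Nat.cast_smul_eq_nsmul ℝ, smul_smul, one_div, inv_mul_cancel₀ hT0, one_smul,
    sub_add_cancel]

end IsIIDWithWeights

/-! ### The stationary distribution -/

theorem bind_eq_sum_map {α V : Type*} [Fintype α] [MeasurableSpace V] {w : α → ℝ}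
    {F : α → V → V} (hF : ∀ p, Measurable (F p)) {κ : Kernel V V}
    (hκ : ∀ x, κ x = ∑ p, ENNReal.ofReal (w p) • Measure.dirac (F p x)) (μ : Measure V) :
    μ.bind κ = ∑ p, ENNReal.ofReal (w p) • μ.map (F p) := by
  ext s hs
  have hm : ∀ p, Measurable fun x => Measure.dirac (F p x) s := fun p =>
    (Measure.measurable_coe hs).comp (Measure.measurable_dirac.comp (hF p))
  rw [Measure.bind_apply hs κ.measurable.aemeasurable]
  simp only [hκ, Measure.coe_finsetSum, Finset.sum_apply, Measure.smul_apply, smul_eq_mul]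
  rw [lintegral_finsetSum _ fun p _ => (hm p).const_mul _]
  refine Finset.sum_congr rfl fun p _ => ?_
  rw [lintegral_const_mul _ (hm p), Measure.map_apply (hF p) hs]
  simp only [Measure.dirac_apply' _ hs]
  congr 1
  exact lintegral_indicator_one (hF p hs)

theorem integral_bind_eq_integral_transfer {α V : Type*} [Fintype α] [MeasurableSpace V]
    [TopologicalSpace V] [OpensMeasurableSpace V] {w : α → ℝ} (hw : ∀ p, 0 ≤ w p)
    {F : α → V → V} (hF : ∀ p, Measurable (F p)) {κ : Kernel V V}
    (hκ : ∀ x, κ x = ∑ p, ENNReal.ofReal (w p) • Measure.dirac (F p x)) (μ : Measure V)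
    [IsFiniteMeasure μ] {g : V → ℝ} (hg : Continuous g) {C : ℝ} (hC : ∀ x, |g x| ≤ C) :
    ∫ x, g x ∂(μ.bind κ) = ∫ x, transfer w F g x ∂μ := by
  have hint : ∀ (ν : Measure V) [IsFiniteMeasure ν], Integrable g ν := fun ν _ =>
    Integrable.of_bound hg.measurable.aestronglyMeasurable C (ae_of_all _ hC)
  have hint2 : ∀ p, Integrable (fun x => g (F p x)) μ := fun p =>
    Integrable.of_bound (hg.measurable.comp (hF p)).aestronglyMeasurable C
      (ae_of_all _ fun x => hC _)
  rw [bind_eq_sum_map hF hκ, integral_finsetSum_measure fun p _ =>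
    (hint (μ.map (F p))).smul_measure ENNReal.ofReal_ne_top]
  simp only [transfer]
  rw [integral_finsetSum _ fun p _ => (hint2 p).const_mul _]
  refine Finset.sum_congr rfl fun p _ => ?_
  rw [integral_smul_measure, integral_map (hF p).aemeasurable
    hg.measurable.aestronglyMeasurable, integral_const_mul, ENNReal.toReal_ofReal (hw p),
    smul_eq_mul]

theorem abs_transfer_le {α V : Type*} [Fintype α] {w : α → ℝ} (hw : ∀ p, 0 ≤ w p)
    (hw1 : ∑ p, w p = 1) (F : α → V → V) {g : V → ℝ} {C : ℝ} (hC : ∀ x, |g x| ≤ C) (x : V) :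
    |transfer w F g x| ≤ C := by
  calc _ ≤ ∑ p, w p * C := (Finset.abs_sum_le_sum_abs _ _).trans
        (Finset.sum_le_sum fun p _ => by
          rw [abs_mul, abs_of_nonneg (hw p)]
          exact mul_le_mul_of_nonneg_left (hC _) (hw p))
    _ = C := by rw [← Finset.sum_mul, hw1, one_mul]

theorem Continuous.transfer {α V : Type*} [Fintype α] [TopologicalSpace V] (w : α → ℝ)
    {F : α → V → V} (hF : ∀ p, Continuous (F p)) {g : V → ℝ} (hg : Continuous g) :
    Continuous (transfer w F g) :=
  continuous_finsetSum _ fun p _ => continuous_const.mul (hg.comp (hF p))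

/-- Transfer is dual to the action of the kernel on measures, and it preserves continuity and the
bound `C`, so the duality can be iterated. -/
theorem integral_eq_integral_transfer_iterate {α V : Type*} [Fintype α] [MeasurableSpace V]
    [TopologicalSpace V] [BorelSpace V] {w : α → ℝ} (hw : ∀ p, 0 ≤ w p)
    (hw1 : ∑ p, w p = 1) {F : α → V → V} (hF : ∀ p, Continuous (F p)) {κ : Kernel V V}
    (hκ : ∀ x, κ x = ∑ p, ENNReal.ofReal (w p) • Measure.dirac (F p x)) {μ : Measure V}
    [IsFiniteMeasure μ] (hμ : κ.Invariant μ) {C : ℝ} (t : ℕ) {g : V → ℝ} (hg : Continuous g)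
    (hC : ∀ x, |g x| ≤ C) :
    ∫ x, (transfer w F)^[t] g x ∂μ = ∫ x, g x ∂μ := by
  induction t generalizing g with
  | zero => rfl
  | succ t ih =>
    rw [Function.iterate_succ_apply, ih (hg.transfer w hF) (abs_transfer_le hw hw1 F hC),
      ← integral_bind_eq_integral_transfer hw (fun p => (hF p).measurable) hκ μ hg hC, hμ.def]

/-- If the iterates of the transfer operator converge to the integrals against `π`, then `π` is
the unique stationary distribution. -/
theorem invariant_iff_eq_of_tendsto_transfer {α V : Type*} [Fintype α] [MeasurableSpace V]
    [PseudoEMetricSpace V] [BorelSpace V] {w : α → ℝ} (hw : ∀ p, 0 ≤ w p)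
    (hw1 : ∑ p, w p = 1) {F : α → V → V} (hF : ∀ p, Continuous (F p)) {κ : Kernel V V}
    (hκ : ∀ x, κ x = ∑ p, ENNReal.ofReal (w p) • Measure.dirac (F p x))
    {π : ProbabilityMeasure V}
    (hπ : ∀ g : BoundedContinuousFunction V ℝ, ∀ x,
      Tendsto (fun t => (transfer w F)^[t] g x) atTop (𝓝 (∫ y, g y ∂(π : Measure V))))
    (μ : ProbabilityMeasure V) :
    κ.Invariant (μ : Measure V) ↔ μ = π := by
  have habs : ∀ (g : BoundedContinuousFunction V ℝ) x, |g x| ≤ ‖g‖ := fun g x =>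
    g.norm_coe_le_norm x
  have hiter : ∀ (g : BoundedContinuousFunction V ℝ) t,
      Continuous ((transfer w F)^[t] g) ∧ ∀ x, |(transfer w F)^[t] g x| ≤ ‖g‖ := fun g t => by
    induction t with
    | zero => exact ⟨g.continuous, habs g⟩
    | succ t ih =>
      rw [Function.iterate_succ_apply']
      exact ⟨ih.1.transfer w hF, abs_transfer_le hw hw1 F ih.2⟩
  constructor
  · intro hμ
    suffices h : (μ : Measure V) = π from Subtype.ext h
    refine ext_of_forall_integral_eq_of_IsFiniteMeasure fun g => ?_
    -- By invariance of `μ` this sequence is constantly the integral of `g` against `μ`, while its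
    -- limit is the integral against `π`.
    have h1 : Tendsto (fun t => ∫ x, (transfer w F)^[t] g x ∂(μ : Measure V)) atTop
        (𝓝 (∫ _, (∫ y, g y ∂(π : Measure V)) ∂(μ : Measure V))) :=
      tendsto_integral_of_dominated_convergence (fun _ => ‖g‖)
        (fun t => (hiter g t).1.measurable.aestronglyMeasurable) (integrable_const _)
        (fun t => ae_of_all _ (hiter g t).2) (ae_of_all _ fun x => hπ g x)
    simp only [integral_eq_integral_transfer_iterate hw hw1 hF hκ hμ _ g.continuous (habs g)]
      at h1
    simpa using tendsto_nhds_unique tendsto_const_nhds h1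
  · rintro rfl
    have hprob : IsProbabilityMeasure ((μ : Measure V).bind κ) := by
      have : IsMarkovKernel κ := ⟨fun x => ⟨by
        rw [hκ]
        simp only [Measure.coe_finsetSum, Finset.sum_apply, Measure.smul_apply, smul_eq_mul,
          measure_univ, mul_one]
        rw [← ENNReal.ofReal_sum_of_nonneg fun p _ => hw p, hw1, ENNReal.ofReal_one]⟩⟩
      infer_instance
    refine ext_of_forall_integral_eq_of_IsFiniteMeasure fun g => ?_
    rw [integral_bind_eq_integral_transfer hw (fun p => (hF p).measurable) hκ _ g.continuous
      (habs g)]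
    obtain ⟨x⟩ : Nonempty V := (μ : Measure V).nonempty_of_neZero
    -- The iterates on `Tg` are the iterates on `g` shifted by one, so `Tg` and `g` have equal
    -- integrals against `π`.
    let Tg : BoundedContinuousFunction V ℝ := BoundedContinuousFunction.ofNormedAddCommGroup
      (transfer w F g) (g.continuous.transfer w hF) ‖g‖ (abs_transfer_le hw hw1 F (habs g))
    have h1 := hπ Tg x
    have h2 := (tendsto_add_atTop_iff_nat 1).2 (hπ g x)
    exact tendsto_nhds_unique h1 h2

theorem continuous_affineStep {α ι : Type*} [Fintype ι] (A : α → Matrix ι ι ℝ) (b : α → ι → ℝ)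
    (p : α) :
    Continuous (affineStep A b p) :=
  (continuous_const.matrix_mulVec continuous_id).add continuous_const

namespace IsIIDWithWeights

variable {α ι Ω : Type*} [Fintype α] [Fintype ι] [DecidableEq ι] [MeasurableSpace α]
  [MeasurableSingletonClass α] [MeasurableSpace Ω] {P : Measure Ω} [IsProbabilityMeasure P]
  {e : ℕ → Ω → α} {w : α → ℝ} {A : α → Matrix ι ι ℝ} {b : α → ι → ℝ} {r : ℝ}

theorem tendsto_integral_forwardIter (he : IsIIDWithWeights P e w)
    (hA : ∀ p i j, 0 ≤ A p i j) (hr0 : 0 ≤ r) (hr1 : r < 1)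
    (hr : ∀ i, (meanMatrix w A).mulVec 1 i ≤ r) {xr : ι → ℝ}
    (hxr : (meanMatrix w A).mulVec xr + ∑ p, w p • b p = xr) (x : ι → ℝ) (i : ι) :
    Tendsto (fun t => ∫ ω, forwardIter (affineStep A b) (fun k => e k ω) x t i ∂P) atTop
      (𝓝 (xr i)) := by
  simp only [he.integral_forwardIter (affineStep A b) x _ fun y => y i,
    transfer_iterate_eval he.sum_weight A b hxr i]
  simpa using (Matrix.tendsto_pow_mulVec (he.meanMatrix_nonneg hA) hr0 hr1 hr (x - xr) i).const_add
    (xr i)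

/-- Existence, uniqueness, mean and attractivity of the stationary distribution. -/
theorem exists_stationary (he : IsIIDWithWeights P e w)
    (hA : ∀ p i j, 0 ≤ A p i j) (hr0 : 0 ≤ r) (hr1 : r < 1)
    (hr : ∀ i, (meanMatrix w A).mulVec 1 i ≤ r) {xr : ι → ℝ}
    (hxr : (meanMatrix w A).mulVec xr + ∑ p, w p • b p = xr) {x : ι → ℝ} {C : ℝ}
    (hx : ∀ i, |x i| ≤ C)
    (hC : ∀ p y, (∀ i, |y i| ≤ C) → ∀ i, |affineStep A b p y i| ≤ C)
    {κ : Kernel (ι → ℝ) (ι → ℝ)}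
    (hκ : ∀ x, κ x = ∑ p, ENNReal.ofReal (w p) • Measure.dirac (affineStep A b p x)) :
    ∃ π : ProbabilityMeasure (ι → ℝ),
      (∀ μ : ProbabilityMeasure (ι → ℝ), κ.Invariant (μ : Measure (ι → ℝ)) ↔ μ = π) ∧
      Integrable (fun y => y) (π : Measure (ι → ℝ)) ∧
      ∫ y, y ∂(π : Measure (ι → ℝ)) = xr ∧
      TendstoInDistribution
        (fun t ω => forwardIter (affineStep A b) (fun k => e k ω) x t) atTop
        (fun y : ι → ℝ => y) (fun _ => P) (π : Measure (ι → ℝ)) := by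
  obtain ⟨Y, hY, hlim⟩ := he.exists_ae_tendsto_backwardIter b hA hr0 hr1 hr
  set F := affineStep A b with hF
  have hFc : ∀ p, Continuous (F p) := continuous_affineStep A b
  let π : ProbabilityMeasure (ι → ℝ) := ⟨P.map Y, Measure.isProbabilityMeasure_map hY⟩
  have hπint : ∀ g : (ι → ℝ) → ℝ, Continuous g →
      ∫ y, g y ∂(π : Measure (ι → ℝ)) = ∫ ω, g (Y ω) ∂P := fun g hg =>
    integral_map hY hg.measurable.aestronglyMeasurable
  have hmeas : ∀ y t, Measurable fun ω => backwardIter F (fun k => e k ω) t y := fun y t =>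
    he.measurable_of_dependsOn (dependsOn_backwardIter F y t)
  have htr : ∀ g : BoundedContinuousFunction (ι → ℝ) ℝ, ∀ y,
      Tendsto (fun t => (transfer w F)^[t] g y) atTop (𝓝 (∫ z, g z ∂(π : Measure (ι → ℝ)))) := by
    intro g y
    rw [hπint g g.continuous]
    simp only [← he.integral_backwardIter F g _ y]
    refine tendsto_integral_of_dominated_convergence (fun _ => ‖g‖)
      (fun t => (g.continuous.measurable.comp (hmeas y t)).aestronglyMeasurable)
      (integrable_const _) (fun t => ae_of_all _ fun ω => g.norm_coe_le_norm _) ?_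
    filter_upwards [hlim] with ω hω
    exact (g.continuous.tendsto _).comp (hω y)
  -- Coordinates are unbounded test functions, so weak convergence alone does not give the mean; the
  -- box preserved by every map supplies the dominating constant.
  have hbd : ∀ s t y, (∀ i, |y i| ≤ C) → ∀ i, |backwardIter F s t y i| ≤ C := fun s t => by
    induction t with
    | zero => exact fun y hy => hy
    | succ t ih => exact fun y hy => ih _ (hC _ y hy)
  have hYbd : ∀ᵐ ω ∂P, ∀ i, |Y ω i| ≤ C := by
    filter_upwards [hlim] with ω hω i
    exact le_of_tendsto ((tendsto_pi_nhds.1 (hω x) i).abs)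
      (Eventually.of_forall fun t => hbd _ t x hx i)
  have hYi : ∀ i, Integrable (fun ω => Y ω i) P := fun i =>
    Integrable.of_bound ((measurable_pi_apply i).comp_aemeasurable hY).aestronglyMeasurable C
      (hYbd.mono fun ω h => h i)
  have hπi : ∀ i, Integrable (fun y : ι → ℝ => y i) (π : Measure (ι → ℝ)) := fun i =>
    (integrable_map_measure (measurable_pi_apply i).aestronglyMeasurable hY).2 (hYi i)
  refine ⟨π, invariant_iff_eq_of_tendsto_transfer he.weight_nonneg he.sum_weight hFc hκ htr,
    Integrable.of_eval hπi, ?_, ?_⟩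
  · funext i
    rw [eval_integral hπi, hπint (fun y => y i) (continuous_apply i)]
    have h1 : Tendsto (fun t => ∫ ω, backwardIter F (fun k => e k ω) t x i ∂P) atTop
        (𝓝 (∫ ω, Y ω i ∂P)) := by
      refine tendsto_integral_of_dominated_convergence (fun _ => C)
        (fun t => ((measurable_pi_apply i).comp (hmeas x t)).aestronglyMeasurable)
        (integrable_const _) (fun t => ae_of_all _ fun ω => hbd _ t x hx i) ?_
      filter_upwards [hlim] with ω hω using tendsto_pi_nhds.1 (hω x) i
    -- Forward and backward means agree at each time, and the forward means tend to `xr`.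
    refine tendsto_nhds_unique h1 ?_
    have h2 := he.tendsto_integral_forwardIter hA hr0 hr1 hr hxr x i
    simp only [he.integral_forwardIter (affineStep A b) x _ fun y => y i] at h2
    simpa only [he.integral_backwardIter F (fun y => y i) _ x] using h2
  · have hfw : ∀ t, Measurable fun ω => forwardIter F (fun k => e k ω) x t := fun t =>
      he.measurable_of_dependsOn (dependsOn_forwardIter F x t)
    refine ⟨fun t => (hfw t).aemeasurable, aemeasurable_id', ?_⟩
    refine ProbabilityMeasure.tendsto_iff_forall_integral_tendsto.2 fun g => ?_
    simp only [ProbabilityMeasure.coe_mk, Measure.map_id']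
    refine (htr g x).congr fun t => ?_
    rw [integral_map (hfw t).aemeasurable g.continuous.measurable.aestronglyMeasurable,
      he.integral_forwardIter F x t g]

end IsIIDWithWeights

/-! ### The gossip model -/

namespace GossipModel

variable {n : ℕ} (M : GossipModel n)

theorem R_mulVec (i j : Fin n) (x : Fin n → ℝ) (k : Fin n) :
    (M.R i j).mulVec x k = if k ∈ M.regular then
      if k = i then M.q * x i + (1 - M.q) * x j
      else if k = j then M.q * x j + (1 - M.q) * x i else x k
    else x k := by
  have hdot : ∀ a b : Fin n,
      (Pi.single a (1 : ℝ) - Pi.single b 1 : Fin n → ℝ) ⬝ᵥ x = x a - x b := fun a b => by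
    simp [sub_dotProduct]
  have hvec : ∀ (u : Fin n → ℝ) (a b : Fin n),
      (1 - (1 - M.q) • Matrix.vecMulVec u (Pi.single a 1 - Pi.single b 1)).mulVec x k =
        x k - (1 - M.q) * (u k * (x a - x b)) := fun u a b => by
    rw [Matrix.sub_mulVec, Matrix.one_mulVec, Matrix.smul_mulVec, Matrix.vecMulVec_mulVec, hdot]
    simp
  unfold R
  simp only
  by_cases hi : i ∈ M.regular <;> by_cases hj : j ∈ M.regular <;> by_cases hk : k ∈ M.regular <;>
    simp only [hi, hj, hk, if_true, if_false, hvec, Matrix.one_mulVec, Pi.sub_apply,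
      Pi.single_apply] <;>
    by_cases hki : k = i <;> by_cases hkj : k = j <;>
    simp only [hki, hkj, if_true, if_false] <;> grind

theorem R_nonneg (i j k l : Fin n) : 0 ≤ M.R i j k l := by
  have h : M.R i j k l = (M.R i j).mulVec (Pi.single l 1) k := by
    rw [Matrix.mulVec_single_one, Matrix.col_apply]
  have h0 : ∀ a, (0 : ℝ) ≤ (Pi.single l 1 : Fin n → ℝ) a := fun a => by
    rw [Pi.single_apply]
    split_ifs <;> norm_num
  have hq := M.q_nonneg
  have hq' := sub_nonneg.2 M.q_lt_one.le
  rw [h, R_mulVec]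
  split_ifs <;>
    first
      | exact h0 _
      | exact add_nonneg (mul_nonneg hq (h0 _)) (mul_nonneg hq' (h0 _))

theorem R_mulVec_one (i j k : Fin n) : (M.R i j).mulVec 1 k = 1 := by
  rw [R_mulVec]
  split_ifs <;> simp

/-- The full state with regular part `y` and stubborn part `z`. -/
def glue (y : M.Reg → ℝ) (z : M.Stub → ℝ) (l : Fin n) : ℝ :=
  if h : l ∈ M.regular then y ⟨l, h⟩ else z ⟨l, h⟩

/-- Splitting the columns of the update matrix into regular and stubborn ones reduces statements
about `A` and `B` to the row-stochastic matrix `R`. -/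
theorem A_mulVec_add_B_mulVec (i j : Fin n) (y : M.Reg → ℝ) (z : M.Stub → ℝ) (k : M.Reg) :
    ((M.A i j).mulVec y + (M.B i j).mulVec z) k = (M.R i j).mulVec (M.glue y z) k := by
  simp only [Pi.add_apply, Matrix.mulVec, dotProduct, A, B, Matrix.submatrix_apply]
  rw [← Fintype.sum_subtype_add_sum_subtype (fun l => l ∈ M.regular)]
  congr 1
  · exact Finset.sum_congr (by ext; simp) fun l _ => by simp [glue, l.2]
  · exact Fintype.sum_congr _ _ fun l => by simp [glue, l.2]

/-- The affine parts of the one-step maps. -/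
def offset (p : Fin n × Fin n) : M.Reg → ℝ := (M.B p.1 p.2).mulVec M.xs

theorem affineStep_eq_stepReg :
    affineStep (fun p : Fin n × Fin n => M.A p.1 p.2) M.offset = M.stepReg := rfl

theorem stepReg_apply (p : Fin n × Fin n) (y : M.Reg → ℝ) (k : M.Reg) :
    M.stepReg p y k = (M.R p.1 p.2).mulVec (M.glue y M.xs) k :=
  M.A_mulVec_add_B_mulVec p.1 p.2 y M.xs k

/-- Each step takes convex combinations, and the norm of the full initial state also bounds the
stubborn entries. -/
theorem abs_stepReg_le (p : Fin n × Fin n) (y : M.Reg → ℝ) (hy : ∀ i, |y i| ≤ ‖M.x0‖)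
    (k : M.Reg) : |M.stepReg p y k| ≤ ‖M.x0‖ := by
  rw [stepReg_apply]
  refine (Matrix.abs_mulVec_le_of_nonneg (M.R_nonneg p.1 p.2) (c := ‖M.x0‖) (fun l => ?_) k).trans
    (by rw [R_mulVec_one, mul_one])
  unfold glue
  split_ifs
  · exact hy _
  · exact norm_le_pi_norm M.x0 l

section StateSequence

variable {Ω : Type*} (edge : ℕ → Ω → Fin n × Fin n)

theorem X_of_notMem {j : Fin n} (hj : j ∉ M.regular) (ω : Ω) :
    ∀ t, M.X edge t ω j = M.x0 j
  | 0 => rfl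
  | t + 1 => by rw [X, R_mulVec, if_neg hj, X_of_notMem hj ω t]

theorem Xr_eq_forwardIter (ω : Ω) (t : ℕ) :
    M.Xr edge t ω = forwardIter M.stepReg (fun s => edge s ω) (fun i => M.x0 i) t := by
  induction t with
  | zero => rfl
  | succ t ih =>
    rw [forwardIter, ← ih]
    funext k
    rw [stepReg_apply]
    have : M.X edge t ω = M.glue (M.Xr edge t ω) M.xs := by
      funext l
      unfold glue
      split_ifs with h
      · rfl
      · exact M.X_of_notMem edge h ω t
    rw [← this]
    rfl

end StateSequence

/-! ### Selection probabilities and contraction on average -/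

/-- The selection probabilities of the pairs. -/
def weight (p : Fin n × Fin n) : ℝ := if p.1 < p.2 then M.W p.1 p.2 else 0

theorem sum_weight_eq_one : ∑ p, M.weight p = 1 := by
  have h1 : ∑ i, ∑ j, M.W i j = ∑ i, ∑ j, (M.weight (i, j) + M.weight (j, i)) := by
    refine Finset.sum_congr rfl fun i _ => Finset.sum_congr rfl fun j _ => ?_
    rcases lt_trichotomy i j with h | rfl | h
    · simp [weight, h, h.not_gt]
    · simp [weight, M.W_diag]
    · simp [weight, h, h.not_gt, M.W_symm i j]
  have h2 := M.W_sum
  simp only [h1, Finset.sum_add_distrib] at h2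
  rw [Finset.sum_comm (f := fun i j => M.weight (j, i))] at h2
  rw [Fintype.sum_prod_type]
  linarith

theorem kernel_apply (x : M.Reg → ℝ) :
    M.kernel x = ∑ p, ENNReal.ofReal (M.weight p) • Measure.dirac (M.stepReg p x) := by
  change ∑ p ∈ pairs n, ENNReal.ofReal (M.W p.1 p.2) • Measure.dirac (M.stepReg p x) = _
  rw [pairs, Finset.sum_filter]
  refine Finset.sum_congr rfl fun p _ => ?_
  unfold weight
  split_ifs <;> simp

variable {M} in
-- The law prescribes only the masses of pairs with `i < j`. These already sum to 1, so all other
-- pairs have mass zero.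
theorem IsEdgeSelection.isIIDWithWeights {Ω : Type*} [MeasurableSpace Ω] {P : Measure Ω}
    [IsProbabilityMeasure P] {edge : ℕ → Ω → Fin n × Fin n} (h : M.IsEdgeSelection P edge) :
    IsIIDWithWeights P edge M.weight := by
  refine ⟨h.measurable, h.indep, fun t p => ?_⟩
  have hle : ∀ p, M.weight p ≤ P.real {ω | edge t ω = p} := fun p => by
    unfold weight
    split_ifs with hp
    · rw [measureReal_def, h.law t p (by simp [pairs, hp]), ENNReal.toReal_ofReal (M.W_nonneg _ _)]
    · exact measureReal_nonneg
  have hsum : ∑ p, P.real {ω | edge t ω = p} = 1 := by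
    have := sum_measureReal_preimage_singleton (μ := P) (f := edge t) Finset.univ
      fun p _ => h.measurable t (measurableSet_singleton p)
    rw [Finset.coe_univ, Set.preimage_univ, probReal_univ] at this
    exact this
  exact (((Finset.sum_eq_sum_iff_of_le fun p _ => hle p).1
    (M.sum_weight_eq_one.trans hsum.symm)) p (Finset.mem_univ p)).symm

/-- The row sums of `A` are the values of `R` on the indicator of the regular agents. An interaction
of `k` with the stubborn `j` mixes in the value 0 with weight `1 - q`. -/
theorem A_mulVec_one_le {j : Fin n} (hj : j ∉ M.regular) (p : Fin n × Fin n) (k : M.Reg) :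
    (M.A p.1 p.2).mulVec 1 k ≤
      1 - if p = (k.1, j) ∨ p = (j, k.1) then 1 - M.q else 0 := by
  have hz : ∀ i : Fin n, |M.glue 1 0 i| ≤ 1 := fun i => by
    unfold glue
    split_ifs <;> simp
  have hk : k.1 ≠ j := fun h => hj (h ▸ k.2)
  have h := M.A_mulVec_add_B_mulVec p.1 p.2 1 0 k
  rw [Matrix.mulVec_zero, add_zero] at h
  rw [h]
  split_ifs with hp
  · have h1 : M.glue 1 0 k.1 = 1 := by simp [glue, k.2]
    have h2 : M.glue 1 0 j = 0 := by simp [glue, hj]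
    rw [R_mulVec, if_pos k.2]
    rcases hp with rfl | rfl
    · simp [h1, h2]
    · simp [h1, h2, hk]
  · have := Matrix.abs_mulVec_le_of_nonneg (M.R_nonneg p.1 p.2) hz k
    rw [R_mulVec_one] at this
    linarith [le_abs_self ((M.R p.1 p.2).mulVec (M.glue 1 0) k)]

theorem weight_nonneg (p : Fin n × Fin n) : 0 ≤ M.weight p := by
  unfold weight
  split_ifs
  exacts [M.W_nonneg _ _, le_rfl]

/-- A stubborn agent that interacts with every regular agent makes `E[A]` a contraction. -/
theorem meanMatrix_A_mulVec_one_le {j : Fin n} (hj : j ∉ M.regular) {δ : ℝ}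
    (hδ : ∀ k ∈ M.regular, δ ≤ M.W k j) (k : M.Reg) :
    (meanMatrix M.weight fun p => M.A p.1 p.2).mulVec 1 k ≤ 1 - (1 - M.q) * δ := by
  have hk : k.1 ≠ j := fun h => hj (h ▸ k.2)
  -- Only the increasing ordering of the pair carries weight.
  obtain ⟨p₀, hp₀, hw₀⟩ : ∃ p₀ : Fin n × Fin n, (p₀ = (k.1, j) ∨ p₀ = (j, k.1)) ∧
      M.weight p₀ = M.W k j := by
    rcases lt_or_gt_of_ne hk with h | h
    · exact ⟨(k.1, j), Or.inl rfl, by simp [weight, h]⟩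
    · exact ⟨(j, k.1), Or.inr rfl, by simp [weight, h, M.W_symm k j]⟩
  have hq := sub_nonneg.2 M.q_lt_one.le
  calc (meanMatrix M.weight fun p => M.A p.1 p.2).mulVec 1 k
      = ∑ p, M.weight p * (M.A p.1 p.2).mulVec 1 k := by
        simp [meanMatrix, Matrix.sum_mulVec, Matrix.smul_mulVec]
    _ ≤ ∑ p, M.weight p * (1 - if p = p₀ then 1 - M.q else 0) := by
        refine Finset.sum_le_sum fun p _ => mul_le_mul_of_nonneg_left
          ((M.A_mulVec_one_le hj p k).trans ?_) (M.weight_nonneg p)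
        gcongr
        split_ifs with h1 h2
        · exact le_rfl
        · exact absurd (h1 ▸ hp₀) h2
        · exact hq
        · exact le_rfl
    _ = 1 - (1 - M.q) * M.W k j := by
        simp [mul_sub, Finset.sum_sub_distrib, M.sum_weight_eq_one, hw₀]
        ring
    _ ≤ 1 - (1 - M.q) * δ := by
        gcongr
        exact hδ k k.2

end GossipModel

/-! ### The two-community theorem -/

theorem theorem1 {n : ℕ} (M : GossipModel n) (C : Fin n → Fin 2) (ws wd : ℝ)
    (hM : M.TwoCommunity C ws wd) (hstub : ∃ j, j ∉ M.regular)
    {Ω : Type*} [MeasurableSpace Ω] (P : Measure Ω) [IsProbabilityMeasure P]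
    (edge : ℕ → Ω → Fin n × Fin n) (hedge : M.IsEdgeSelection P edge) :
    ∃ xr : M.Reg → ℝ,
      -- the value of the limit, where `E[A(s)]` and `E[B(s)]` do not depend on `s`
      (∀ s : ℕ, IsUnit (1 - expMatrix P (M.randA edge s)) ∧
        xr = (1 - expMatrix P (M.randA edge s))⁻¹.mulVec
          ((expMatrix P (M.randB edge s)).mulVec M.xs)) ∧
      -- (i) unique stationary distribution, its mean, and convergence in distribution
      (∃ π : ProbabilityMeasure (M.Reg → ℝ),
        M.IsStationary π ∧
        (∀ μ : ProbabilityMeasure (M.Reg → ℝ), M.IsStationary μ → μ = π) ∧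
        Integrable (fun x => x) (π : Measure (M.Reg → ℝ)) ∧
        ∫ x, x ∂(π : Measure (M.Reg → ℝ)) = xr ∧
        TendstoInDistribution (M.Xr edge) atTop (fun x : M.Reg → ℝ => x) (fun _ => P)
          (π : Measure (M.Reg → ℝ))) ∧
      -- (ii) convergence of the expectations
      (∀ t, Integrable (M.Xr edge t) P) ∧
      Tendsto (fun t => ∫ ω, M.Xr edge t ω ∂P) atTop (𝓝 xr) ∧
      -- (iii) almost sure convergence of the time averages
      (∀ᵐ ω ∂P, Tendsto (fun t => M.Sr edge t ω) atTop (𝓝 xr)) := by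
  obtain ⟨j, hj⟩ := hstub
  have he := hedge.isIIDWithWeights
  set D : Matrix M.Reg M.Reg ℝ := meanMatrix M.weight fun p => M.A p.1 p.2 with hD
  -- This bound holds whichever community the stubborn agent `j` belongs to.
  set δ := min ws wd with hδdef
  have hδ : 0 < δ := lt_min hM.ws_pos hM.wd_pos
  have hWδ : ∀ k ∈ M.regular, δ ≤ M.W k j := fun k hk => by
    rw [hM.block, if_neg (ne_of_mem_of_not_mem hk hj)]
    split_ifs
    exacts [min_le_left _ _, min_le_right _ _]
  have hr := M.meanMatrix_A_mulVec_one_le hj hWδ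
  have hA : ∀ (p : Fin n × Fin n) i k, 0 ≤ M.A p.1 p.2 i k := fun p i k => M.R_nonneg _ _ _ _
  have hr1 : 1 - (1 - M.q) * δ < 1 := by
    have := mul_pos (sub_pos.2 M.q_lt_one) hδ
    linarith
  -- The bound dominates a nonnegative row sum; a row exists because there is a regular agent.
  have hr0 : 0 ≤ 1 - (1 - M.q) * δ := by
    obtain ⟨k, hk, -⟩ := hM.regular_mem 0
    refine le_trans ?_ (hr ⟨k, hk⟩)
    simp only [Matrix.mulVec, dotProduct, Pi.one_apply, mul_one]
    exact Finset.sum_nonneg fun i _ => he.meanMatrix_nonneg hA _ i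
  have hunit : IsUnit (1 - D) :=
    Matrix.isUnit_one_sub_of_nonneg (he.meanMatrix_nonneg hA) hr0 hr1 hr
  have hEA : ∀ s, expMatrix P (M.randA edge s) = D := fun s => by
    ext i k
    simp only [expMatrix, Matrix.of_apply, GossipModel.randA, hD, meanMatrix, Matrix.sum_apply,
      Matrix.smul_apply, smul_eq_mul]
    exact he.integral_apply s fun p => M.A p.1 p.2 i k
  have hEB : ∀ s, (expMatrix P (M.randB edge s)).mulVec M.xs =
      ∑ p, M.weight p • M.offset p := fun s => by
    have : expMatrix P (M.randB edge s) = meanMatrix M.weight fun p => M.B p.1 p.2 := by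
      ext i k
      simp only [expMatrix, Matrix.of_apply, GossipModel.randB, meanMatrix, Matrix.sum_apply,
        Matrix.smul_apply, smul_eq_mul]
      exact he.integral_apply s fun p => M.B p.1 p.2 i k
    rw [this]
    simp only [meanMatrix, Matrix.sum_mulVec, Matrix.smul_mulVec, GossipModel.offset]
  set xr : M.Reg → ℝ := (1 - D)⁻¹.mulVec (∑ p, M.weight p • M.offset p) with hxrdef
  have hxr : D.mulVec xr + ∑ p, M.weight p • M.offset p = xr := by
    have h : (1 - D).mulVec xr = ∑ p, M.weight p • M.offset p := by
      rw [hxrdef, Matrix.mulVec_mulVec,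
        Matrix.mul_nonsing_inv _ ((Matrix.isUnit_iff_isUnit_det _).1 hunit), Matrix.one_mulVec]
    rw [← h, Matrix.sub_mulVec, Matrix.one_mulVec, add_sub_cancel]
  have hx0 : ∀ i : M.Reg, |M.x0 i| ≤ ‖M.x0‖ := fun i => norm_le_pi_norm M.x0 i
  have hX : M.Xr edge = fun t ω => forwardIter
      (affineStep (fun p : Fin n × Fin n => M.A p.1 p.2) M.offset) (fun s => edge s ω)
      (fun i => M.x0 i) t := by
    funext t ω
    rw [M.Xr_eq_forwardIter, M.affineStep_eq_stepReg]
  obtain ⟨π, hπ, hint, hmean, hdist⟩ := he.exists_stationary hA hr0 hr1 hr hxr hx0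
    M.abs_stepReg_le M.kernel_apply
  have hXint : ∀ t (i : M.Reg), Integrable (fun ω => M.Xr edge t ω i) P := fun t i => by
    rw [hX]
    exact he.integrable_of_dependsOn fun _ _ h =>
      congrArg (fun y : M.Reg → ℝ => y i) (dependsOn_forwardIter _ _ t h)
  refine ⟨xr, fun s => ?_, ⟨π, (hπ π).2 rfl, fun μ => (hπ μ).1, hint, hmean, ?_⟩,
    fun t => Integrable.of_eval (hXint t), ?_, ?_⟩
  · rw [hEA, hEB]
    exact ⟨hunit, rfl⟩
  · rw [hX]
    exact hdist
  · refine tendsto_pi_nhds.2 fun i => ?_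
    simp only [eval_integral (hXint _)]
    rw [hX]
    exact he.tendsto_integral_forwardIter hA hr0 hr1 hr hxr _ i
  · unfold GossipModel.Sr
    rw [hX]
    exact he.ae_tendsto_average_forwardIter hunit hxr hx0 M.abs_stepReg_le
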